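/- Let $AP$ be a finite set. A computation is an infinite word $\pi=\pi_0\pi_1\dots$ over the alphabet $\mathcal P(AP)$, and $\pi^i=\pi_i\pi_{i+1}\dots$. A discounting function is a strictly decreasing $\eta:\mathbb N\to[0,1]$ with $\lim_{i\to\infty}\eta(i)=0$. Let $\mathcal D$ be a set of discounting functions, and let $\mathcal F_{\mathrm{mc}}$ be the set of all functions $f:[0,1]^k\to[0,1]$, $k\in\mathbb N$, that are monotone (non-decreasing in the componentwise order) and continuous. The formulas of $\mathrm{LTL}^{\mathrm{disc}}[\mathcal D,\mathcal F_{\mathrm{mc}}]$ are $$\varphi::=\mathtt{True}\mid p\mid\neg\varphi\mid\varphi\wedge\varphi\mid\mathsf X\varphi\mid\varphi\,\mathsf U\,\varphi\mid\varphi\,\mathsf U_\eta\,\varphi\mid f(\varphi,\dots,\varphi)\qquad(p\in AP,\ \eta\in\mathcal D,\ f\in\mathcal F_{\mathrm{mc}}),$$ and the truth value $[\![\pi,\varphi]\!]\in[0,1]$ is defined by: $[\![\pi,\mathtt{True}]\!]=1$; $[\![\pi,p]\!]=1$ if $p\in\pi_0$ and $0$ otherwise; $[\![\pi,\neg\varphi]\!]=1-[\![\pi,\varphi]\!]$;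 $[\![\pi,\varphi_1\wedge\varphi_2]\!]=\min\{[\![\pi,\varphi_1]\!],[\![\pi,\varphi_2]\!]\}$; $[\![\pi,\mathsf X\varphi]\!]=[\![\pi^1,\varphi]\!]$; $[\![\pi,\varphi_1\mathsf U\varphi_2]\!]=\sup_{i\in\mathbb N}\min\{[\![\pi^i,\varphi_2]\!],\min_{0\le j<i}[\![\pi^j,\varphi_1]\!]\}$; $[\![\pi,\varphi_1\mathsf U_\eta\varphi_2]\!]=\sup_{i\in\mathbb N}\min\{\eta(i)[\![\pi^i,\varphi_2]\!],\min_{0\le j<i}\eta(j)[\![\pi^j,\varphi_1]\!]\}$; $[\![\pi,f(\varphi_1,\dots,\varphi_k)]\!]=f([\![\pi,\varphi_1]\!],\dots,[\![\pi,\varphi_k]\!])$ (a minimum over the empty set is $1$). A discount sequence is a nonempty finite sequence $\vec d=d_1d_2\dots d_n$ of numbers in $[0,1]$. It acts on $v\in[0,1]$ by $d\boxtimes v=dv$ for length one and $(\vec d\,d')\boxtimes v=\vec d\boxtimes(1-d'v)$. An alternating $[0,1]$-acceptance automaton over a finite alphabet $\Sigma$ is a tuple $\mathcal A=(\Sigma,Q,I,\delta,F)$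 with a finite set $Q$ of states, a set $I\subseteq Q$ of initial states, a transition function $\delta:Q\times\Sigma\to\mathcal B^+(Q\cup[0,1])$ (disjoint union) into the positive propositional formulas (built with $\wedge,\vee,\top,\bot$) over the atoms $Q\cup[0,1]$, and $F:Q\to[0,1]$. A run over $w=a_0a_1\dots\in\Sigma^\omega$ is a finitely branching rooted tree, possibly of infinite depth, with nodes labelled from $Q\cup[0,1]$, such that the root is labelled with a state in $I$, every node labelled with a number is a leaf, and, for every node of depth $i$ labelled with a state $q$, the set of labels of its children satisfies the formula $\delta(q,a_i)$. A path of a run is a branch from the root that is infinite or ends in a leaf. The value $F^\infty(\rho)$ of an infinite path $\rho$ is $\max\{F(q)\mid q\in Q\text{ occurs infinitely often as a label in }\rho\}$; that of a finite path is $v$ if its last node is labelled with the number $v$, and $1$ if its last node is labelled with a state. The language of $\mathcal A$ is $$\mathcal L(\mathcal A)(w)=\sup_{\tau\text{ run over }w}\ \inf_{\rho\text{ path of }\tau}F^\infty(\rho)\in[0,1],$$ the supremum being $0$ if there is no run. Then for every formula $\varphi$ of $\mathrm{LTL}^{\mathrm{disc}}[\mathcal D,\mathcal F_{\mathrm{mc}}]$,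 every $\varepsilon\in(0,1)$ and every discount sequence $\vec d$, there is an alternating $[0,1]$-acceptance automaton $\mathcal A$ over the alphabet $\mathcal P(AP)$ such that, for every computation $\pi\in(\mathcal P(AP))^\omega$, $$\bigl(\vec d\boxtimes[\![\pi,\varphi]\!]\bigr)-\varepsilon\ \le\ \mathcal L(\mathcal A)(\pi)\ \le\ \vec d\boxtimes[\![\pi,\varphi]\!].$$ -/

import Mathlib

namespace LTLDisc

/-! ### The logic `LTLdisc[𝒟, ℱ]` -/

/-- A discounting function: a strictly decreasing `η : ℕ → [0,1]` with limit `0`. -/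
structure DiscountingFunction where
  toFun : ℕ → unitInterval
  strictAnti' : StrictAnti toFun
  tendsto_zero' : Filter.Tendsto toFun Filter.atTop (nhds 0)

/-- A propositional quality operator: an arity `k` and a function `[0,1]^k → [0,1]`. -/
structure QualityOperator where
  arity : ℕ
  toFun : (Fin arity → unitInterval) → unitInterval

/-- The set of monotone and continuous propositional quality operators. -/
def monotoneContinuousOperators : Set QualityOperator :=
  {f | Monotone f.toFun ∧ Continuous f.toFun}

/-- Formulas of `LTLdisc[𝒟, ℱ]` over the atomic propositions `AP`. -/
inductive Formula (AP : Type*) (𝒟 : Set DiscountingFunction) (ℱ : Set QualityOperator) where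
  | tru : Formula AP 𝒟 ℱ
  | atom (p : AP) : Formula AP 𝒟 ℱ
  | neg (φ : Formula AP 𝒟 ℱ) : Formula AP 𝒟 ℱ
  | and (φ₁ φ₂ : Formula AP 𝒟 ℱ) : Formula AP 𝒟 ℱ
  | next (φ : Formula AP 𝒟 ℱ) : Formula AP 𝒟 ℱ
  | untl (φ₁ φ₂ : Formula AP 𝒟 ℱ) : Formula AP 𝒟 ℱ
  | discUntl (η : DiscountingFunction) (hη : η ∈ 𝒟) (φ₁ φ₂ : Formula AP 𝒟 ℱ) : Formula AP 𝒟 ℱ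
  | op (f : QualityOperator) (hf : f ∈ ℱ) (φ : Fin f.arity → Formula AP 𝒟 ℱ) : Formula AP 𝒟 ℱ

/-- A computation over `AP`: an infinite word over the powerset of `AP`. -/
abbrev Computation (AP : Type*) := ℕ → Set AP

/-- The suffix `π^i = π_i π_{i+1} …`. -/
def suffix {AP : Type*} (π : Computation AP) (i : ℕ) : Computation AP := fun n => π (i + n)

open Classical in
/-- The truth value `⟦π, φ⟧ ∈ [0,1]`. Suprema and infima are taken in the complete lattice
`[0,1]`; in particular the minimum over the empty index set (`i = 0`) is `1`. -/
noncomputable def Formula.sem {AP : Type*} {𝒟 : Set DiscountingFunction}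
    {ℱ : Set QualityOperator} : Formula AP 𝒟 ℱ → Computation AP → unitInterval
  | .tru, _ => 1
  | .atom p, π => if p ∈ π 0 then 1 else 0
  | .neg φ, π => unitInterval.symm (φ.sem π)
  | .and φ₁ φ₂, π => min (φ₁.sem π) (φ₂.sem π)
  | .next φ, π => φ.sem (suffix π 1)
  | .untl φ₁ φ₂, π =>
      ⨆ i : ℕ, min (φ₂.sem (suffix π i)) (⨅ j : Fin i, φ₁.sem (suffix π j))
  | .discUntl η _ φ₁ φ₂, π =>
      ⨆ i : ℕ, min (η.toFun i * φ₂.sem (suffix π i))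
        (⨅ j : Fin i, η.toFun j * φ₁.sem (suffix π j))
  | .op f _ φ, π => f.toFun fun i => (φ i).sem π

/-! ### Discount sequences -/

/-- Discount sequences, i.e. nonempty finite sequences `d₁ d₂ … dₙ` over `[0,1]`, built by
appending the last element. -/
inductive DiscountSeq where
  | single (d : unitInterval) : DiscountSeq
  | snoc (ds : DiscountSeq) (d : unitInterval) : DiscountSeq

/-- The action `d⃗ ⊠ v` of a discount sequence on a truth value: `d ⊠ v = d v` and
`(d⃗ d') ⊠ v = d⃗ ⊠ (1 - d' v)`. -/
noncomputable def DiscountSeq.act : DiscountSeq → unitInterval → unitInterval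
  | .single d, v => d * v
  | .snoc ds d, v => ds.act (unitInterval.symm (d * v))

/-! ### Alternating `[0,1]`-acceptance automata -/

/-- Positive propositional formulas over the atomic variables `X`. -/
inductive PosBool (X : Type*) where
  | var (x : X) : PosBool X
  | top : PosBool X
  | bot : PosBool X
  | and (b c : PosBool X) : PosBool X
  | or (b c : PosBool X) : PosBool X

/-- Boolean satisfaction of a positive formula by the set `S` of variables that are true. -/
def PosBool.Sat {X : Type*} (S : Set X) : PosBool X → Prop
  | .var x => x ∈ S
  | .top => True
  | .bot => False
  | .and b c => b.Sat S ∧ c.Sat S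
  | .or b c => b.Sat S ∨ c.Sat S

/-- An alternating `[0,1]`-acceptance (Büchi) automaton over the finite alphabet `A`. -/
structure AltAutomaton (A : Type*) [Finite A] where
  Q : Type
  finite_Q : Finite Q
  init : Set Q
  δ : Q → A → PosBool (Q ⊕ unitInterval)
  F : Q → unitInterval

namespace AltAutomaton

variable {A : Type*} [Finite A]

/-- A run tree over the word `w`. Nodes are finite sequences of natural numbers (the root is `[]`,
the children of `t` are the nodes `t ++ [i]`, the depth of `t` is its length); every node has
finitely many children. -/
structure Run (𝒜 : AltAutomaton A) (w : ℕ → A) where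
  nodes : Set (List ℕ)
  root_mem : [] ∈ nodes
  parent_mem : ∀ (t : List ℕ) (i : ℕ), t ++ [i] ∈ nodes → t ∈ nodes
  finite_children : ∀ t ∈ nodes, {i : ℕ | t ++ [i] ∈ nodes}.Finite
  label : List ℕ → 𝒜.Q ⊕ unitInterval
  label_root : ∃ q ∈ 𝒜.init, label [] = Sum.inl q
  /-- A node that is labelled with a number is a leaf. -/
  label_num : ∀ t ∈ nodes, ∀ v : unitInterval, label t = Sum.inr v → ∀ i : ℕ, t ++ [i] ∉ nodes
  /-- The labels of the children of a node of depth `i` that is labelled with a state `q`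
  satisfy `δ(q, a_i)`. -/
  label_state : ∀ t ∈ nodes, ∀ q : 𝒜.Q, label t = Sum.inl q →
    (𝒜.δ q (w t.length)).Sat {l | ∃ i : ℕ, t ++ [i] ∈ nodes ∧ l = label (t ++ [i])}

/-- Paths of a run tree from the root: a finite path is determined by the leaf in which it ends,
and an infinite path is a sequence of nodes, each a child of the preceding one. -/
inductive Run.Path {𝒜 : AltAutomaton A} {w : ℕ → A} (τ : 𝒜.Run w) where
  | finite (t : List ℕ) (mem : t ∈ τ.nodes) (leaf : ∀ i : ℕ, t ++ [i] ∉ τ.nodes) : Run.Path τ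
  | infinite (ρ : ℕ → List ℕ) (root : ρ 0 = []) (mem : ∀ n, ρ n ∈ τ.nodes)
      (step : ∀ n, ∃ i : ℕ, ρ (n + 1) = ρ n ++ [i]) : Run.Path τ

/-- The value `F^∞(ρ)` of a path: on an infinite path, the greatest acceptance value of a state
that occurs infinitely often; on a finite path, the number that labels its last node, or `1` if
its last node is labelled with a state. -/
noncomputable def Run.Path.value {𝒜 : AltAutomaton A} {w : ℕ → A} {τ : 𝒜.Run w} :
    τ.Path → unitInterval
  | .finite t _ _ => Sum.elim (fun _ => 1) id (τ.label t)
  | .infinite ρ _ _ _ =>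
      sSup {v | ∃ q : 𝒜.Q, (∃ᶠ n in Filter.atTop, τ.label (ρ n) = Sum.inl q) ∧ v = 𝒜.F q}

/-- The weighted language: the best run, valued by its worst path. (If there is no run over `w`,
the value is the least element `0` of `[0,1]`.) -/
noncomputable def language (𝒜 : AltAutomaton A) (w : ℕ → A) : unitInterval :=
  ⨆ τ : 𝒜.Run w, ⨅ ρ : τ.Path, ρ.value

end AltAutomaton

end LTLDisc

/-! Call a function of computations a step function if it has finitely many values and each of its
level sets is defined by an LTL formula. Every map `φ.sem` is a uniform limit of step functions
(`approximable_sem`). Such limits are closed under continuous operations, because these are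
uniformly continuous on a compact cube (`Approximable.comp`). They are closed under until, because
min, inf and sup do not increase uniform distances and the until of two step functions is again a
step function (`IsStep.untl`). A discounted until is, up to an error `η N`, a continuous function of
the values on finitely many suffixes (`Approximable.discUntl`). The discount sequence acts
continuously, so it adds nothing new.

A step function with values `v k` on the sets defined by `ψ k` is computed by an automaton. Its
initial state is a guess of `k`; its first transition emits a leaf labelled `v k` and starts the
usual alternating Büchi automaton for `ψ k`. A correct guess has a run of value at least `v k`
(`le_language_thresholdAutomaton`), while a wrong guess forces a path of value `0`
(`language_thresholdAutomaton_le`). Lowering an `ε / 2`-approximation by `ε / 2` makes the error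
one-sided. -/

namespace LTLDisc

/-! ### Runs built from a positional strategy -/

namespace AltAutomaton

variable {A : Type*} [Finite A]

/-- The label of the node with reversed address `t` in the tree unravelled from the state `q₀`,
where `σ n q` lists the labels of the children of a node of depth `n` with label `q`. -/
def treeLabel {Q X : Type*} (σ : ℕ → Q → List (Q ⊕ X)) (q₀ : Q) : List ℕ → Option (Q ⊕ X)
  | [] => some (Sum.inl q₀)
  | i :: t =>
    match treeLabel σ q₀ t with
    | some (Sum.inl q) => (σ t.length q)[i]?
    | _ => none

theorem treeLabel_cons_eq_some {Q X : Type*} {σ : ℕ → Q → List (Q ⊕ X)} {q₀ : Q} {i : ℕ}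
    {t : List ℕ} {l : Q ⊕ X} :
    treeLabel σ q₀ (i :: t) = some l ↔
      ∃ q, treeLabel σ q₀ t = some (Sum.inl q) ∧ (σ t.length q)[i]? = some l := by
  rw [treeLabel]
  split
  · rename_i q h
    simp [h]
  · rename_i h
    simp only [reduceCtorEq, false_iff]
    rintro ⟨q, hq, -⟩
    exact h q hq

/-- The run that follows a strategy `σ` preserving an invariant `Good`. -/
def strategyRun (𝒜 : AltAutomaton A) (w : ℕ → A) (σ : ℕ → 𝒜.Q → List (𝒜.Q ⊕ unitInterval))
    (Good : ℕ → 𝒜.Q ⊕ unitInterval → Prop) (q₀ : 𝒜.Q) (hinit : q₀ ∈ 𝒜.init)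
    (hgood : ∀ t l, treeLabel σ q₀ t = some l → Good t.length l)
    (hsat : ∀ n q, Good n (Sum.inl q) → (𝒜.δ q (w n)).Sat {l | l ∈ σ n q}) : 𝒜.Run w where
  nodes := {t | (treeLabel σ q₀ t.reverse).isSome}
  root_mem := by simp [treeLabel]
  parent_mem t i h := by
    simp only [Set.mem_ofPred_eq, List.reverse_append, List.reverse_cons, List.reverse_nil,
      List.nil_append, List.cons_append, Option.isSome_iff_exists, treeLabel_cons_eq_some] at h ⊢
    obtain ⟨_, q, hq, -⟩ := h
    exact ⟨_, hq⟩
  finite_children t _ := by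
    simp only [Set.mem_ofPred_eq, List.reverse_append, List.reverse_cons, List.reverse_nil,
      List.nil_append, List.cons_append, Option.isSome_iff_exists, treeLabel_cons_eq_some]
    by_cases h : ∃ q, treeLabel σ q₀ t.reverse = some (Sum.inl q)
    · obtain ⟨q, hq⟩ := h
      refine (Set.finite_Iio (σ t.reverse.length q).length).subset ?_
      rintro i ⟨l, q', hq', hi⟩
      obtain rfl : q = q' := by simpa [hq] using hq'
      exact (List.getElem?_eq_some_iff.1 hi).1
    · convert Set.finite_empty
      ext i
      simp only [Set.mem_ofPred_eq, Set.mem_empty_iff_false, iff_false]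
      rintro ⟨l, q, hq, -⟩
      exact h ⟨q, hq⟩
  label t := (treeLabel σ q₀ t.reverse).getD (Sum.inl q₀)
  label_root := ⟨q₀, hinit, rfl⟩
  label_num t ht v hv i hi := by
    simp only [Set.mem_ofPred_eq, List.reverse_append, List.reverse_cons, List.reverse_nil,
      List.nil_append, List.cons_append, Option.isSome_iff_exists, treeLabel_cons_eq_some] at hi
    obtain ⟨_, q, hq, -⟩ := hi
    simp [hq] at hv
  label_state t ht q hq := by
    obtain ⟨l, hl⟩ := Option.isSome_iff_exists.1 ht
    obtain rfl : l = Sum.inl q := by simpa [hl] using hq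
    have := hsat _ q (hgood _ _ hl)
    rw [List.length_reverse] at this
    convert this using 1
    ext l
    simp only [Set.mem_ofPred_eq, List.reverse_append, List.reverse_cons, List.reverse_nil,
      List.nil_append, List.cons_append, Option.isSome_iff_exists, treeLabel_cons_eq_some,
      List.mem_iff_getElem?, hl, Option.some.injEq, Sum.inl.injEq, List.length_reverse]
    constructor
    · rintro ⟨i, ⟨l', q', rfl, hi⟩, rfl⟩
      refine ⟨i, ?_⟩
      rw [treeLabel_cons_eq_some.2 ⟨q, hl, by simpa using hi⟩]
      simpa using hi
    · rintro ⟨i, hi⟩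
      refine ⟨i, ⟨l, q, rfl, hi⟩, ?_⟩
      rw [treeLabel_cons_eq_some.2 ⟨q, hl, by simpa using hi⟩]
      rfl

/-- Unravelling `σ` from `q₀` gives a run in which `Good` holds at every node. A leaf labelled with
a number is covered by `hnum`, a leaf labelled with a state counts as `1`, and infinite paths are
covered by `hinf`. -/
theorem le_language_of_strategy (𝒜 : AltAutomaton A) (w : ℕ → A) (v : unitInterval)
    (σ : ℕ → 𝒜.Q → List (𝒜.Q ⊕ unitInterval)) (Good : ℕ → 𝒜.Q ⊕ unitInterval → Prop)
    (q₀ : 𝒜.Q) (hinit : q₀ ∈ 𝒜.init) (h₀ : Good 0 (Sum.inl q₀))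
    (hstep : ∀ n q, Good n (Sum.inl q) → ∀ l ∈ σ n q, Good (n + 1) l)
    (hsat : ∀ n q, Good n (Sum.inl q) → (𝒜.δ q (w n)).Sat {l | l ∈ σ n q})
    (hnum : ∀ n u, Good n (Sum.inr u) → v ≤ u)
    (hinf : ∀ q : ℕ → 𝒜.Q, (∀ n, Good n (Sum.inl (q n))) →
      (∀ n, Sum.inl (q (n + 1)) ∈ σ n (q n)) → ∃ p, (∃ᶠ n in Filter.atTop, q n = p) ∧ v ≤ 𝒜.F p) :
    v ≤ 𝒜.language w := by
  have hgood : ∀ t l, treeLabel σ q₀ t = some l → Good t.length l := by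
    intro t
    induction t with
    | nil =>
      intro l hl
      obtain rfl : Sum.inl q₀ = l := by simpa [treeLabel] using hl
      exact h₀
    | cons i t ih =>
      intro l hl
      obtain ⟨q, hq, hi⟩ := treeLabel_cons_eq_some.1 hl
      exact hstep _ q (ih _ hq) l (List.mem_iff_getElem?.2 ⟨i, hi⟩)
  refine le_iSup_of_le (strategyRun 𝒜 w σ Good q₀ hinit hgood hsat) (le_iInf fun ρ => ?_)
  cases ρ with
  | finite t mem leaf =>
    obtain ⟨l, hl⟩ := Option.isSome_iff_exists.1 mem
    have hlab : (strategyRun 𝒜 w σ Good q₀ hinit hgood hsat).label t = l := by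
      simp [strategyRun, hl]
    rw [Run.Path.value, hlab]
    cases l with
    | inl q => exact unitInterval.le_one'
    | inr u => exact hnum _ u (hgood _ _ hl)
  | infinite ρ root mem step =>
    -- Each node of an infinite path has a child, so its label cannot be a number.
    have hq : ∀ n, ∃ q, treeLabel σ q₀ (ρ n).reverse = some (Sum.inl q) := by
      intro n
      obtain ⟨i, hi⟩ := step n
      have := mem (n + 1)
      rw [hi] at this
      simp only [strategyRun, Set.mem_ofPred_eq, List.reverse_append, List.reverse_cons,
        List.reverse_nil, List.nil_append, List.cons_append, Option.isSome_iff_exists,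
        treeLabel_cons_eq_some] at this
      obtain ⟨_, q, hq, -⟩ := this
      exact ⟨q, hq⟩
    choose q hq using hq
    have hlen : ∀ n, (ρ n).length = n := by
      intro n
      induction n with
      | zero => simp [root]
      | succ n ih =>
        obtain ⟨i, hi⟩ := step n
        simp [hi, ih]
    obtain ⟨p, hp, hv⟩ := hinf q
      (fun n => by simpa [hlen] using hgood _ _ (hq n))
      (fun n => by
        obtain ⟨i, hi⟩ := step n
        have := hq (n + 1)
        rw [hi, List.reverse_append, List.reverse_singleton, List.singleton_append,
          treeLabel_cons_eq_some] at this
        obtain ⟨q', hq', hi'⟩ := this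
        obtain rfl : q n = q' := by simpa [hq n] using hq'
        rw [List.length_reverse, hlen] at hi'
        exact List.mem_iff_getElem?.2 ⟨i, hi'⟩)
    rw [Run.Path.value]
    refine hv.trans (le_sSup ⟨p, hp.mono fun n hn => ?_, rfl⟩)
    simp [strategyRun, hq, hn]

end AltAutomaton

/-! ### Linear temporal logic in negation normal form -/

/-- LTL formulas in negation normal form over the alphabet `B`. -/
inductive LTL (B : Type) where
  | lit (S : Set B) : LTL B
  | and (φ ψ : LTL B) : LTL B
  | or (φ ψ : LTL B) : LTL B
  | next (φ : LTL B) : LTL B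
  | untl (φ ψ : LTL B) : LTL B
  | release (φ ψ : LTL B) : LTL B

namespace LTL

variable {B : Type}

/-- Satisfaction of a formula by the word `w` at a position. -/
def Holds (w : ℕ → B) : LTL B → ℕ → Prop
  | lit S, n => w n ∈ S
  | and φ ψ, n => φ.Holds w n ∧ ψ.Holds w n
  | or φ ψ, n => φ.Holds w n ∨ ψ.Holds w n
  | next φ, n => φ.Holds w (n + 1)
  | untl φ ψ, n => ∃ i, ψ.Holds w (n + i) ∧ ∀ j < i, φ.Holds w (n + j)
  | release φ ψ, n => ∀ i, ψ.Holds w (n + i) ∨ ∃ j < i, φ.Holds w (n + j)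

/-- The negation of a formula, again in negation normal form. -/
def dual : LTL B → LTL B
  | lit S => lit Sᶜ
  | and φ ψ => or φ.dual ψ.dual
  | or φ ψ => and φ.dual ψ.dual
  | next φ => next φ.dual
  | untl φ ψ => release φ.dual ψ.dual
  | release φ ψ => untl φ.dual ψ.dual

theorem holds_dual (w : ℕ → B) (φ : LTL B) (n : ℕ) : φ.dual.Holds w n ↔ ¬ φ.Holds w n := by
  induction φ generalizing n with
  | lit S => rfl
  | and φ ψ ih₁ ih₂ => simp only [dual, Holds, ih₁, ih₂]; tauto
  | or φ ψ ih₁ ih₂ => simp only [dual, Holds, ih₁, ih₂]; tauto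
  | next φ ih => simp only [dual, Holds, ih]
  | untl φ ψ ih₁ ih₂ => simp only [dual, Holds, ih₁, ih₂]; push Not; grind
  | release φ ψ ih₁ ih₂ => simp only [dual, Holds, ih₁, ih₂]; push Not; rfl

theorem holds_shift (w : ℕ → B) (i : ℕ) (φ : LTL B) (n : ℕ) :
    φ.Holds (fun m => w (i + m)) n ↔ φ.Holds w (i + n) := by
  induction φ generalizing n <;> simp_all [Holds, add_assoc]

/-- The height of the syntax tree. -/
def height : LTL B → ℕ
  | lit _ => 0
  | and φ ψ => max φ.height ψ.height + 1
  | or φ ψ => max φ.height ψ.height + 1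
  | next φ => φ.height + 1
  | untl φ ψ => max φ.height ψ.height + 1
  | release φ ψ => max φ.height ψ.height + 1

/-- The set of subformulas. -/
def sub : LTL B → Set (LTL B)
  | lit S => {lit S}
  | and φ ψ => insert (and φ ψ) (φ.sub ∪ ψ.sub)
  | or φ ψ => insert (or φ ψ) (φ.sub ∪ ψ.sub)
  | next φ => insert (next φ) φ.sub
  | untl φ ψ => insert (untl φ ψ) (φ.sub ∪ ψ.sub)
  | release φ ψ => insert (release φ ψ) (φ.sub ∪ ψ.sub)

theorem mem_sub_self (φ : LTL B) : φ ∈ φ.sub := by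
  cases φ <;> simp [sub]

theorem finite_sub (φ : LTL B) : φ.sub.Finite := by
  induction φ <;> simp_all [sub]

theorem sub_subset_sub {φ ψ : LTL B} (h : φ ∈ ψ.sub) : φ.sub ⊆ ψ.sub := by
  induction ψ <;> grind [sub]

open Classical in
/-- The formula to be satisfied in the next position, the obligation `χ` being written `emb χ`. -/
noncomputable def trans {X : Type*} (emb : LTL B → PosBool X) (b : B) : LTL B → PosBool X
  | lit S => if b ∈ S then .top else .bot
  | and φ ψ => .and (φ.trans emb b) (ψ.trans emb b)
  | or φ ψ => .or (φ.trans emb b) (ψ.trans emb b)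
  | next φ => emb φ
  | untl φ ψ => .or (ψ.trans emb b) (.and (φ.trans emb b) (emb (untl φ ψ)))
  | release φ ψ => .and (ψ.trans emb b) (.or (φ.trans emb b) (emb (release φ ψ)))

open Classical in
/-- A choice of obligations for position `n + 1` that guarantees a true formula at position `n`
and fulfils eventualities as soon as possible. -/
noncomputable def obligations (w : ℕ → B) (n : ℕ) : LTL B → List (LTL B)
  | lit _ => []
  | and φ ψ => φ.obligations w n ++ ψ.obligations w n
  | or φ ψ => if φ.Holds w n then φ.obligations w n else ψ.obligations w n
  | next φ => [φ]
  | untl φ ψ =>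
    if ψ.Holds w n then ψ.obligations w n else untl φ ψ :: φ.obligations w n
  | release φ ψ =>
    ψ.obligations w n ++ if φ.Holds w n then φ.obligations w n else [release φ ψ]

theorem obligations_subset_sub (w : ℕ → B) (n : ℕ) {φ χ : LTL B}
    (h : χ ∈ φ.obligations w n) : χ ∈ φ.sub := by
  induction φ <;> grind [sub, obligations, mem_sub_self]

/-- The automaton is very weak: its only loops are self-loops, created when an until or a release is
postponed. -/
theorem eq_or_height_lt_of_mem_obligations (w : ℕ → B) (n : ℕ) {φ χ : LTL B}
    (h : χ ∈ φ.obligations w n) : χ = φ ∨ χ.height < φ.height := by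
  induction φ <;> grind [obligations, height]

theorem holds_untl_iff (w : ℕ → B) (φ ψ : LTL B) (n : ℕ) :
    (untl φ ψ).Holds w n ↔ ψ.Holds w n ∨ φ.Holds w n ∧ (untl φ ψ).Holds w (n + 1) := by
  simp only [Holds]
  constructor
  · rintro ⟨_ | i, h, h'⟩
    · exact .inl h
    · refine .inr ⟨h' 0 i.succ_pos, i, by grind, fun j hj => ?_⟩
      have := h' (j + 1) (by omega)
      grind
  · rintro (h | ⟨h, i, hi, hj⟩)
    · exact ⟨0, h, by simp⟩
    · refine ⟨i + 1, by grind, ?_⟩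
      rintro (_ | j) hlt
      · exact h
      · have := hj j (by omega)
        grind

theorem holds_release_iff (w : ℕ → B) (φ ψ : LTL B) (n : ℕ) :
    (release φ ψ).Holds w n ↔
      ψ.Holds w n ∧ (φ.Holds w n ∨ (release φ ψ).Holds w (n + 1)) := by
  have := holds_untl_iff w φ.dual ψ.dual n
  have h (m : ℕ) := holds_dual w (release φ ψ) m
  simp only [dual] at h
  simp only [h, holds_dual] at this
  grind

theorem holds_of_mem_obligations (w : ℕ → B) (n : ℕ) {φ χ : LTL B} (hφ : φ.Holds w n)
    (h : χ ∈ φ.obligations w n) : χ.Holds w (n + 1) := by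
  induction φ with
  | lit S => simp [obligations] at h
  | and φ ψ ih₁ ih₂ => grind [obligations, Holds]
  | or φ ψ ih₁ ih₂ => grind [obligations, Holds]
  | next φ ih => grind [obligations, Holds]
  | untl φ ψ ih₁ ih₂ => rw [holds_untl_iff] at hφ; grind [obligations]
  | release φ ψ ih₁ ih₂ => rw [holds_release_iff] at hφ; grind [obligations]

theorem sat_trans_of_obligations {X : Type*} (emb : LTL B → PosBool X) (w : ℕ → B) (n : ℕ)
    (S : Set X) {φ : LTL B} (hφ : φ.Holds w n)
    (h : ∀ χ ∈ φ.obligations w n, (emb χ).Sat S) : (φ.trans emb (w n)).Sat S := by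
  induction φ with
  | lit T => rw [Holds] at hφ; simp [trans, hφ, PosBool.Sat]
  | and φ ψ ih₁ ih₂ => grind [obligations, Holds, trans, PosBool.Sat]
  | or φ ψ ih₁ ih₂ => grind [obligations, Holds, trans, PosBool.Sat]
  | next φ ih => grind [obligations, Holds, trans, PosBool.Sat]
  | untl φ ψ ih₁ ih₂ =>
    rw [holds_untl_iff] at hφ; grind [obligations, trans, PosBool.Sat]
  | release φ ψ ih₁ ih₂ =>
    rw [holds_release_iff] at hφ; grind [obligations, trans, PosBool.Sat]

/-- Whether a formula is an eventuality `φ U ψ`. -/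
def IsUntl : LTL B → Prop
  | untl _ _ => True
  | _ => False

/-- A sequence of successive obligations is eventually constant, and its limit is no
eventuality. -/
theorem exists_frequently_eq_of_obligations (w : ℕ → B) (χ : ℕ → LTL B)
    (hstep : ∀ᶠ n in Filter.atTop, (χ n).Holds w n ∧ χ (n + 1) ∈ (χ n).obligations w n) :
    ∃ φ, (∃ᶠ n in Filter.atTop, χ n = φ) ∧ ¬ φ.IsUntl := by
  obtain ⟨N, hN⟩ := Filter.eventually_atTop.1 hstep
  have hanti : Antitone fun n => (χ (N + n)).height := by
    refine antitone_nat_of_succ_le fun n => ?_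
    rcases eq_or_height_lt_of_mem_obligations w _ (hN (N + n) (by omega)).2 with h | h
    · rw [← add_assoc, h]
    · rw [← add_assoc]; exact h.le
  obtain ⟨M, hM⟩ := WellFoundedLT.antitone_chain_condition hanti
  have hconst : ∀ n, χ (N + M + n) = χ (N + M) := by
    intro n
    induction n with
    | zero => rfl
    | succ n ih =>
      rcases eq_or_height_lt_of_mem_obligations w _ (hN (N + M + n) (by omega)).2 with h | h
      · rw [← add_assoc, h, ih]
      · have h1 := hM (M + n) (by omega)
        have h2 := hM (M + n + 1) (by omega)
        simp only [← add_assoc] at h1 h2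
        omega
  refine ⟨χ (N + M), Filter.frequently_atTop.2 fun a => ⟨N + M + a, by omega, hconst a⟩, ?_⟩
  intro hu
  have hmem : ∀ n, χ (N + M) ∈ (χ (N + M)).obligations w (N + M + n) := by
    intro n
    have := (hN (N + M + n) (by omega)).2
    rwa [hconst, add_assoc (N + M), hconst] at this
  have hholds := (hN (N + M) (by omega)).1
  generalize χ (N + M) = φ at *
  cases φ with
  | untl φ ψ =>
    obtain ⟨i, hi, -⟩ := hholds
    have := hmem i
    rw [obligations, if_pos hi] at this
    rcases eq_or_height_lt_of_mem_obligations w _ this with h | h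
    · have := congrArg height h
      simp only [height] at this
      omega
    · simp only [height] at h
      omega
  | _ => exact hu

end LTL

/-! ### The automaton of a family of thresholds -/

section ThresholdAutomaton

variable {A : Type*} [Finite A] {B : Type} (e : A → B) {ι : Type}
  (v : ι → unitInterval) (ψ : ι → LTL B)

open Classical in
/-- The atom for a subformula of the family `ψ`. -/
noncomputable def obligationVar (χ : LTL B) :
    PosBool ((ι ⊕ {χ : LTL B // ∃ k, χ ∈ (ψ k).sub}) ⊕ unitInterval) :=
  if h : ∃ k, χ ∈ (ψ k).sub then .var (.inl (.inr ⟨χ, h⟩)) else .bot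

open Classical in
/-- The automaton with value the largest threshold `v k` for which `ψ k` holds. -/
noncomputable def thresholdAutomaton [Finite ι] : AltAutomaton A where
  Q := ι ⊕ {χ : LTL B // ∃ k, χ ∈ (ψ k).sub}
  finite_Q := by
    have : Finite {χ : LTL B // ∃ k, χ ∈ (ψ k).sub} := by
      refine Set.Finite.to_subtype (s := {χ | ∃ k, χ ∈ (ψ k).sub}) ?_
      convert Set.finite_iUnion fun k => (ψ k).finite_sub
      ext
      simp
    infer_instance
  init := Set.range Sum.inl
  δ q a :=
    match q with
    | .inl k => .and (.var (.inr (v k))) ((ψ k).trans (obligationVar ψ) (e a))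
    | .inr χ => χ.1.trans (obligationVar ψ) (e a)
  F q :=
    match q with
    | .inl _ => 0
    | .inr χ => if χ.1.IsUntl then 0 else 1

theorem le_language_thresholdAutomaton [Finite ι] (w : ℕ → A) (k : ι)
    (hk : (ψ k).Holds (fun n => e (w n)) 0) :
    v k ≤ (thresholdAutomaton e v ψ).language w := by
  classical
  set w' : ℕ → B := fun n => e (w n) with hw'
  let T := {χ : LTL B // ∃ k, χ ∈ (ψ k).sub}
  let lbl : LTL B → Option ((ι ⊕ T) ⊕ unitInterval) := fun χ =>
    if h : ∃ k, χ ∈ (ψ k).sub then some (.inl (.inr ⟨χ, h⟩)) else none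
  let σ : ℕ → ι ⊕ T → List ((ι ⊕ T) ⊕ unitInterval) := fun n q =>
    match q with
    | .inl k => .inr (v k) :: ((ψ k).obligations w' n).filterMap lbl
    | .inr χ => (χ.1.obligations w' n).filterMap lbl
  let Good : ℕ → (ι ⊕ T) ⊕ unitInterval → Prop := fun n l =>
    match l with
    | .inl (.inl j) => j = k ∧ n = 0
    | .inl (.inr χ) => χ.1.Holds w' n
    | .inr u => u = v k
  have hlbl : ∀ χ l, lbl χ = some l ↔ ∃ h : ∃ k, χ ∈ (ψ k).sub, l = .inl (.inr ⟨χ, h⟩) := by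
    intro χ l
    by_cases h : ∃ k, χ ∈ (ψ k).sub
    · simp only [lbl, dif_pos h, Option.some.injEq]
      exact ⟨fun hl => ⟨h, hl.symm⟩, fun ⟨_, hl⟩ => hl.symm⟩
    · simp only [lbl, dif_neg h, reduceCtorEq, false_iff]
      exact fun ⟨h', _⟩ => h h'
  have hgood : ∀ n (χ : LTL B), χ.Holds w' n → ∀ l ∈ (χ.obligations w' n).filterMap lbl,
      Good (n + 1) l := by
    intro n χ hχ l hl
    obtain ⟨χ', hχ', hl⟩ := List.mem_filterMap.1 hl
    obtain ⟨h, rfl⟩ := (hlbl _ _).1 hl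
    exact LTL.holds_of_mem_obligations w' n hχ hχ'
  have hsat : ∀ n (χ : LTL B) (S : Set ((ι ⊕ T) ⊕ unitInterval)), (∃ k, χ ∈ (ψ k).sub) →
      χ.Holds w' n → (∀ l ∈ (χ.obligations w' n).filterMap lbl, l ∈ S) →
      (χ.trans (obligationVar ψ) (w' n)).Sat S := by
    intro n χ S ⟨j, hj⟩ hχ hS
    refine LTL.sat_trans_of_obligations _ w' n _ hχ fun χ' hχ' => ?_
    have h : ∃ k, χ' ∈ (ψ k).sub :=
      ⟨j, LTL.sub_subset_sub hj (LTL.obligations_subset_sub w' n hχ')⟩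
    rw [obligationVar, dif_pos h]
    exact hS _ (List.mem_filterMap.2 ⟨χ', hχ', (hlbl _ _).2 ⟨h, rfl⟩⟩)
  refine AltAutomaton.le_language_of_strategy (thresholdAutomaton e v ψ) w (v k) σ Good
    (.inl k) ⟨k, rfl⟩ ⟨rfl, rfl⟩ ?_ ?_ ?_ ?_
  · rintro n (j | χ) hq l hl
    · obtain ⟨rfl, rfl⟩ := hq
      rcases List.mem_cons.1 hl with rfl | hl
      · rfl
      · exact hgood 0 _ hk l hl
    · exact hgood n _ hq l hl
  · rintro n (j | χ) hq
    · obtain ⟨rfl, rfl⟩ := hq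
      exact ⟨List.mem_cons_self, hsat 0 _ _ ⟨j, LTL.mem_sub_self _⟩ hk
        fun l hl => List.mem_cons_of_mem _ hl⟩
    · exact hsat n _ _ χ.2 hq fun l hl => hl
  · rintro n u rfl
    exact le_rfl
  · intro q hq hstep
    have hT : ∀ n, ∃ χ : T, q (n + 1) = .inr χ := by
      intro n
      have := hq (n + 1)
      cases h : q (n + 1) with
      | inl j =>
        rw [h] at this
        exact absurd this.2 n.succ_ne_zero
      | inr χ => exact ⟨χ, rfl⟩
    choose χ hχ using hT
    have hev : ∀ᶠ n in Filter.atTop, (χ (n - 1)).1.Holds w' n ∧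
        (χ (n + 1 - 1)).1 ∈ (χ (n - 1)).1.obligations w' n := by
      refine Filter.eventually_atTop.2 ⟨1, fun n hn => ?_⟩
      obtain ⟨m, rfl⟩ := Nat.exists_eq_add_of_le' hn
      have h1 := hq (m + 1)
      have h2 := hstep (m + 1)
      rw [hχ, hχ] at h2
      rw [hχ] at h1
      refine ⟨h1, ?_⟩
      obtain ⟨φ, hφ, hl⟩ := List.mem_filterMap.1 h2
      obtain ⟨h, hl⟩ := (hlbl _ _).1 hl
      obtain hl := Sum.inr.inj (Sum.inl.inj hl)
      simp only [Nat.add_sub_cancel, hl]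
      exact hφ
    obtain ⟨φ, hφ, hu⟩ := LTL.exists_frequently_eq_of_obligations w' (fun n => (χ (n - 1)).1) hev
    obtain ⟨n, hn⟩ := hφ.exists
    refine ⟨.inr (χ (n - 1)), ?_, ?_⟩
    · refine (hφ.and_eventually (Filter.eventually_ge_atTop 1)).mono ?_
      rintro m ⟨hm, hm1⟩
      obtain ⟨m, rfl⟩ := Nat.exists_eq_add_of_le' hm1
      rw [hχ]
      refine congrArg Sum.inr (Subtype.ext ?_)
      exact hm.trans hn.symm
    · have : (thresholdAutomaton e v ψ).F (.inr (χ (n - 1))) = 1 := by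
        change (if (χ (n - 1)).1.IsUntl then (0 : unitInterval) else 1) = 1
        rw [show (χ (n - 1)).1 = φ from hn, if_neg hu]
      rw [this]
      exact unitInterval.le_one'

end ThresholdAutomaton

theorem AltAutomaton.Run.exists_infinite_path {A : Type*} [Finite A] {𝒜 : AltAutomaton A}
    {w : ℕ → A} (τ : 𝒜.Run w) (P : List ℕ → Prop) (hmem : ∀ t, P t → t ∈ τ.nodes)
    (hP : ∀ t, P t → ∃ i, P (t ++ [i])) (t : List ℕ) (ht : P t) :
    ∃ ρ : ℕ → List ℕ, ρ 0 = [] ∧ (∀ n, ρ n ∈ τ.nodes) ∧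
      (∀ n, ∃ i, ρ (n + 1) = ρ n ++ [i]) ∧ ∀ n ≥ t.length, P (ρ n) := by
  have hpre : ∀ u s, s ++ u ∈ τ.nodes → s ∈ τ.nodes := by
    intro u
    induction u using List.reverseRecOn with
    | nil => simp
    | append_singleton u i ih =>
      intro s hs
      rw [← List.append_assoc] at hs
      exact ih s (τ.parent_mem _ _ hs)
  have hnext : ∀ s : {s // (∃ i u, s ++ i :: u = t) ∨ P s},
      ∃ s' : {s // (∃ i u, s ++ i :: u = t) ∨ P s}, ∃ i, s'.1 = s.1 ++ [i] := by
    rintro ⟨s, ⟨i, u, rfl⟩ | hs⟩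
    · refine ⟨⟨s ++ [i], ?_⟩, i, rfl⟩
      cases u with
      | nil => exact .inr ht
      | cons j u => exact .inl ⟨j, u, by simp⟩
    · obtain ⟨i, hi⟩ := hP s hs
      exact ⟨⟨s ++ [i], .inr hi⟩, i, rfl⟩
  choose f hf using hnext
  have hroot : (∃ i u, [] ++ i :: u = t) ∨ P [] := by
    cases t with
    | nil => exact .inr ht
    | cons i u => exact .inl ⟨i, u, rfl⟩
  let ρ : ℕ → {s // (∃ i u, s ++ i :: u = t) ∨ P s} := fun n => Nat.rec ⟨[], hroot⟩ (fun _ => f) n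
  have hlen : ∀ n, (ρ n).1.length = n := by
    intro n
    induction n with
    | zero => rfl
    | succ n ih =>
      obtain ⟨i, hi⟩ := hf (ρ n)
      change (f (ρ n)).1.length = n + 1
      simp [hi, ih]
  refine ⟨fun n => (ρ n).1, rfl, fun n => ?_, fun n => hf (ρ n), fun n hn => ?_⟩
  · rcases (ρ n).2 with ⟨i, u, h⟩ | h
    · exact hpre (i :: u) _ (by rw [h]; exact hmem t ht)
    · exact hmem _ h
  · refine (ρ n).2.resolve_left ?_
    rintro ⟨i, u, h⟩
    have := congrArg List.length h
    simp [hlen] at this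
    omega

section ThresholdAutomaton

variable {A : Type*} [Finite A] {B : Type} (e : A → B) {ι : Type}
  (v : ι → unitInterval) (ψ : ι → LTL B)

theorem exists_of_sat_obligationVar {χ : LTL B} {S} (h : (obligationVar ψ χ).Sat S) :
    ∃ h : ∃ k, χ ∈ (ψ k).sub, .inl (.inr ⟨χ, h⟩) ∈ S := by
  rw [obligationVar] at h
  split at h
  · exact ⟨_, h⟩
  · exact h.elim

theorem holds_of_sat_trans [Finite ι] (w : ℕ → A) (τ : (thresholdAutomaton e v ψ).Run w)
    (hτ : ∀ ρ : τ.Path, ρ.value ≠ 0) (χ : LTL B) (t : List ℕ) (ht : t ∈ τ.nodes)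
    (h : (χ.trans (obligationVar ψ) (e (w t.length))).Sat
      {l | ∃ i : ℕ, t ++ [i] ∈ τ.nodes ∧ l = τ.label (t ++ [i])}) :
    χ.Holds (fun n => e (w n)) t.length := by
  have hchild : ∀ (t : List ℕ) (χ : LTL B), (obligationVar ψ χ).Sat
      {l | ∃ i : ℕ, t ++ [i] ∈ τ.nodes ∧ l = τ.label (t ++ [i])} →
      ∃ i, t ++ [i] ∈ τ.nodes ∧
        (∃ hχ, τ.label (t ++ [i]) = .inl (.inr ⟨χ, hχ⟩)) ∧
        (χ.trans (obligationVar ψ) (e (w (t ++ [i]).length))).Sat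
          {l | ∃ j : ℕ, t ++ [i] ++ [j] ∈ τ.nodes ∧ l = τ.label (t ++ [i] ++ [j])} := by
    intro t χ h
    obtain ⟨hχ, i, hi, hl⟩ := exists_of_sat_obligationVar ψ h
    exact ⟨i, hi, ⟨hχ, hl.symm⟩, τ.label_state _ hi _ hl.symm⟩
  induction χ generalizing t with
  | lit S =>
    rw [LTL.trans] at h
    split at h
    · assumption
    · exact h.elim
  | and φ ψ ih₁ ih₂ => exact ⟨ih₁ t ht h.1, ih₂ t ht h.2⟩
  | or φ ψ ih₁ ih₂ => exact h.imp (ih₁ t ht) (ih₂ t ht)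
  | next φ ih =>
    obtain ⟨i, hi, -, hs⟩ := hchild _ _ h
    have := ih _ hi hs
    rwa [List.length_append] at this
  | untl φ χ ih₁ ih₂ =>
    by_contra hcon
    let P : List ℕ → Prop := fun s => s ∈ τ.nodes ∧
      ¬ (LTL.untl φ χ).Holds (fun n => e (w n)) s.length ∧
      ((LTL.untl φ χ).trans (obligationVar ψ) (e (w s.length))).Sat
        {l | ∃ i : ℕ, s ++ [i] ∈ τ.nodes ∧ l = τ.label (s ++ [i])}
    have hnext : ∀ s, P s → ∃ i, P (s ++ [i]) ∧
        ∃ hχ, τ.label (s ++ [i]) = .inl (.inr ⟨LTL.untl φ χ, hχ⟩) := by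
      rintro s ⟨hs, hn, hsat⟩
      rw [LTL.holds_untl_iff] at hn
      push Not at hn
      rcases hsat with hsat | ⟨hsat, hsat'⟩
      · exact absurd (ih₂ s hs hsat) hn.1
      · obtain ⟨i, hi, hl, hs'⟩ := hchild _ _ hsat'
        exact ⟨i, ⟨hi, by simpa using hn.2 (ih₁ s hs hsat), hs'⟩, hl⟩
    obtain ⟨i₀, hP₀, hχ, hl₀⟩ := hnext t ⟨ht, hcon, h⟩
    obtain ⟨ρ, hroot, hmem, hstep, hρ⟩ := τ.exists_infinite_path
      (fun s => P s ∧ τ.label s = .inl (.inr ⟨LTL.untl φ χ, hχ⟩)) (fun s hs => hs.1.1)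
      (fun s hs => by
        obtain ⟨i, hi, _, hl⟩ := hnext s hs.1
        exact ⟨i, hi, hl⟩) (t ++ [i₀]) ⟨hP₀, hl₀⟩
    refine hτ (.infinite ρ hroot hmem hstep) (le_antisymm (sSup_le ?_) bot_le)
    rintro _ ⟨q, hq, rfl⟩
    obtain ⟨n, hn, hn'⟩ := (hq.and_eventually (Filter.eventually_ge_atTop _)).exists
    have := hn.symm.trans (hρ n hn').2
    obtain rfl := Sum.inl.inj this
    simp [thresholdAutomaton, LTL.IsUntl]
  | release φ χ ih₁ ih₂ =>
    intro i
    induction i generalizing t with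
    | zero => exact .inl (ih₂ t ht h.1)
    | succ i ih =>
      rcases h.2 with h' | h'
      · exact .inr ⟨0, i.succ_pos, ih₁ t ht h'⟩
      · obtain ⟨j, hj, -, hs⟩ := hchild _ _ h'
        have := ih _ hj hs
        simp only [List.length_append, List.length_singleton] at this
        rcases this with this | ⟨k, hk, this⟩
        · exact .inl (by grind)
        · exact .inr ⟨k + 1, by omega, by grind⟩

theorem language_thresholdAutomaton_le [Finite ι] (w : ℕ → A) (c : unitInterval)
    (hc : ∀ k, (ψ k).Holds (fun n => e (w n)) 0 → v k ≤ c) :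
    (thresholdAutomaton e v ψ).language w ≤ c := by
  refine iSup_le fun τ => ?_
  obtain ⟨_, ⟨k, rfl⟩, hk⟩ := τ.label_root
  obtain ⟨⟨i, hi, hv⟩, hsat⟩ := τ.label_state [] τ.root_mem _ hk
  by_cases hτ : ∀ ρ : τ.Path, ρ.value ≠ 0
  · refine (iInf_le _ (.finite _ hi (τ.label_num _ hi _ hv.symm))).trans ?_
    rw [AltAutomaton.Run.Path.value, ← hv]
    exact hc k (holds_of_sat_trans e v ψ w τ hτ _ [] τ.root_mem hsat)
  · push Not at hτ
    obtain ⟨ρ, hρ⟩ := hτ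
    exact (iInf_le _ ρ).trans (hρ.le.trans bot_le)

end ThresholdAutomaton

/-! ### Step functions with LTL-definable level sets -/

section Definable

variable {AP : Type*} {B : Type} (e : Set AP → B)

/-- A set of computations is definable if it is the language of an LTL formula. -/
def Definable (L : Set (Computation AP)) : Prop :=
  ∃ ψ : LTL B, ∀ π, π ∈ L ↔ ψ.Holds (fun n => e (π n)) 0

variable {e}

theorem definable_letter (S : Set B) : Definable e {π | e (π 0) ∈ S} :=
  ⟨.lit S, fun _ => Iff.rfl⟩

theorem definable_univ : Definable e Set.univ :=
  ⟨.lit Set.univ, fun _ => by simp [LTL.Holds]⟩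

theorem Definable.compl {L : Set (Computation AP)} (h : Definable e L) : Definable e Lᶜ := by
  obtain ⟨ψ, hψ⟩ := h
  exact ⟨ψ.dual, fun π => by rw [LTL.holds_dual, ← hψ]; rfl⟩

theorem Definable.inter {L L' : Set (Computation AP)} (h : Definable e L) (h' : Definable e L') :
    Definable e (L ∩ L') := by
  obtain ⟨ψ, hψ⟩ := h
  obtain ⟨ψ', hψ'⟩ := h'
  exact ⟨ψ.and ψ', fun π => by rw [Set.mem_inter_iff, hψ, hψ']; rfl⟩

theorem Definable.suffix {L : Set (Computation AP)} (h : Definable e L) :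
    Definable e {π | suffix π 1 ∈ L} := by
  obtain ⟨ψ, hψ⟩ := h
  refine ⟨ψ.next, fun π => ?_⟩
  rw [Set.mem_ofPred_eq, hψ]
  exact ψ.holds_shift (fun n => e (π n)) 1 0

theorem Definable.untl {L L' : Set (Computation AP)} (h : Definable e L) (h' : Definable e L') :
    Definable e {π | ∃ i, LTLDisc.suffix π i ∈ L' ∧ ∀ j < i, LTLDisc.suffix π j ∈ L} := by
  obtain ⟨ψ, hψ⟩ := h
  obtain ⟨ψ', hψ'⟩ := h'
  refine ⟨ψ.untl ψ', fun π => ?_⟩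
  have h (χ : LTL B) (i : ℕ) : χ.Holds (fun n => e (LTLDisc.suffix π i n)) 0 ↔
      χ.Holds (fun n => e (π n)) (0 + i) := by
    rw [zero_add]
    exact χ.holds_shift (fun n => e (π n)) i 0
  simp only [Set.mem_ofPred_eq, hψ, hψ', h]
  rfl

theorem definable_biInter {ι : Type*} {s : Set ι} (hs : s.Finite)
    {L : ι → Set (Computation AP)} (h : ∀ i ∈ s, Definable e (L i)) :
    Definable e (⋂ i ∈ s, L i) := by
  induction s, hs using Set.Finite.induction_on with
  | empty => simpa using definable_univ
  | insert _ _ ih =>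
    rw [Set.biInter_insert]
    exact (h _ (Set.mem_insert _ _)).inter (ih fun i hi => h i (Set.mem_insert_of_mem _ hi))

theorem definable_biUnion {ι : Type*} {s : Set ι} (hs : s.Finite)
    {L : ι → Set (Computation AP)} (h : ∀ i ∈ s, Definable e (L i)) :
    Definable e (⋃ i ∈ s, L i) := by
  rw [← compl_compl (⋃ i ∈ s, L i)]
  simp only [Set.compl_iUnion]
  exact (definable_biInter hs fun i hi => (h i hi).compl).compl

variable (e) in
/-- A function of computations with finitely many values and definable level sets. -/
def IsStep {α : Type*} (g : Computation AP → α) : Prop :=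
  (Set.range g).Finite ∧ ∀ T : Set α, Definable e (g ⁻¹' T)

theorem IsStep.of_fibers {α : Type*} {g : Computation AP → α} (hg : (Set.range g).Finite)
    (h : ∀ a, Definable e (g ⁻¹' {a})) : IsStep e g := by
  refine ⟨hg, fun T => ?_⟩
  convert definable_biUnion (hg.inter_of_right T) fun a _ => h a
  ext π
  simp

theorem IsStep.comp {α β : Type*} {g : Computation AP → α} (hg : IsStep e g) (F : α → β) :
    IsStep e fun π => F (g π) :=
  ⟨(hg.1.image F).subset (by rintro _ ⟨π, rfl⟩; exact ⟨_, ⟨π, rfl⟩, rfl⟩),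
    fun T => hg.2 (F ⁻¹' T)⟩

theorem IsStep.pi {ι : Type*} [Finite ι] {α : ι → Type*} {g : ∀ i, Computation AP → α i}
    (hg : ∀ i, IsStep e (g i)) : IsStep e fun π i => g i π := by
  refine .of_fibers ((Set.Finite.pi' fun i => (hg i).1).subset ?_) fun a => ?_
  · rintro _ ⟨π, rfl⟩ i
    exact ⟨π, rfl⟩
  · convert definable_biInter (Set.finite_univ (α := ι)) fun i _ => (hg i).2 {a i}
    ext π
    simp [funext_iff]

theorem IsStep.prop {L : Set (Computation AP)} (h : Definable e L) :
    IsStep e fun π => π ∈ L := by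
  refine .of_fibers (Set.toFinite _) fun p => ?_
  by_cases hp : p
  · convert h
    ext
    simp [hp]
  · convert h.compl
    ext
    simp [hp]

theorem isStep_const {α : Type*} (a : α) : IsStep e fun _ => a :=
  (IsStep.prop definable_univ).comp fun _ => a

theorem IsStep.suffix {α : Type*} {g : Computation AP → α} (hg : IsStep e g) (i : ℕ) :
    IsStep e fun π => g (LTLDisc.suffix π i) := by
  induction i with
  | zero =>
    convert hg with π
    funext n
    simp [LTLDisc.suffix]
  | succ i ih =>
    refine ⟨hg.1.subset ?_, fun T => ?_⟩
    · rintro _ ⟨π, rfl⟩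
      exact ⟨_, rfl⟩
    · convert (ih.2 T).suffix using 1
      ext π
      simp only [Set.mem_preimage, Set.mem_ofPred_eq]
      rw [show LTLDisc.suffix π (i + 1) = LTLDisc.suffix (LTLDisc.suffix π 1) i from
        funext fun n => congrArg π (by omega)]

theorem IsStep.untl {g₁ g₂ : Computation AP → unitInterval} (h₁ : IsStep e g₁)
    (h₂ : IsStep e g₂) : IsStep e fun π => ⨆ i : ℕ, min (g₂ (LTLDisc.suffix π i))
      (⨅ j : Fin i, g₁ (LTLDisc.suffix π j)) := by
  let R : Set unitInterval := insert 1 (Set.range g₁ ∪ Set.range g₂)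
  have hR : R.Finite := (h₁.1.union h₂.1).insert 1
  have : Finite R := hR
  let U : unitInterval → Set (Computation AP) := fun c =>
    {π | ∃ i, LTLDisc.suffix π i ∈ g₂ ⁻¹' Set.Ici c ∧
      ∀ j < i, LTLDisc.suffix π j ∈ g₁ ⁻¹' Set.Ici c}
  have hU : ∀ c : R, IsStep e fun π => π ∈ U c := fun c =>
    .prop ((h₁.2 (Set.Ici c)).untl (h₂.2 (Set.Ici c)))
  convert (IsStep.pi hU).comp fun p : R → Prop => ⨆ c : {c : R // p c}, (c.1 : unitInterval)
    using 2 with π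
  refine le_antisymm (iSup_le fun i => ?_) (iSup_le ?_)
  · have hmem : ∀ i : ℕ, (⨅ j : Fin i, g₁ (LTLDisc.suffix π j)) ∈ R := by
      intro i
      rcases isEmpty_or_nonempty (Fin i) with h | h
      · rw [iInf_of_empty]
        exact Set.mem_insert _ _
      · obtain ⟨j, hj⟩ := exists_eq_ciInf_of_finite (f := fun j : Fin i => g₁ (LTLDisc.suffix π j))
        rw [← hj]
        exact .inr (.inl ⟨_, rfl⟩)
    have hmin : min (g₂ (LTLDisc.suffix π i)) (⨅ j : Fin i, g₁ (LTLDisc.suffix π j)) ∈ R := by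
      rcases min_choice (g₂ (LTLDisc.suffix π i)) (⨅ j : Fin i, g₁ (LTLDisc.suffix π j))
        with h | h <;> rw [h]
      · exact .inr (.inr ⟨_, rfl⟩)
      · exact hmem i
    refine le_iSup_of_le ⟨⟨_, hmin⟩, i, Set.mem_preimage.2 (Set.mem_Ici.2 (min_le_left _ _)),
      fun j hj => Set.mem_preimage.2 (Set.mem_Ici.2 ?_)⟩ le_rfl
    exact (min_le_right _ _).trans (iInf_le (fun j : Fin i => g₁ (LTLDisc.suffix π j)) ⟨j, hj⟩)
  · rintro ⟨c, i, hi, hj⟩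
    exact le_iSup_of_le i (le_min hi (le_iInf fun j => hj j j.2))

end Definable

/-! ### Uniform approximation of truth values by step functions -/

section Approximation

variable {AP : Type*} {B : Type} (e : Set AP → B)

/-- A uniform limit of step functions. -/
def Approximable (s : Computation AP → unitInterval) : Prop :=
  ∀ ε > (0 : ℝ), ∃ g : Computation AP → unitInterval, IsStep e g ∧ ∀ π, dist (s π) (g π) ≤ ε

variable {e}

theorem IsStep.approximable {s : Computation AP → unitInterval} (h : IsStep e s) :
    Approximable e s :=
  fun ε hε => ⟨s, h, fun π => by simpa using hε.le⟩

theorem Approximable.of_forall_dist_le {s : Computation AP → unitInterval}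
    (h : ∀ ε > (0 : ℝ), ∃ s', Approximable e s' ∧ ∀ π, dist (s π) (s' π) ≤ ε) :
    Approximable e s := by
  intro ε hε
  obtain ⟨s', hs', hd⟩ := h (ε / 2) (by positivity)
  obtain ⟨g, hg, hd'⟩ := hs' (ε / 2) (by positivity)
  exact ⟨g, hg, fun π => (dist_triangle _ (s' π) _).trans (by linarith [hd π, hd' π])⟩

theorem Approximable.comp {ι : Type*} [Finite ι] {s : ι → Computation AP → unitInterval}
    (hs : ∀ i, Approximable e (s i)) {F : (ι → unitInterval) → unitInterval}
    (hF : Continuous F) : Approximable e fun π => F fun i => s i π := by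
  have := Fintype.ofFinite ι
  intro ε hε
  obtain ⟨δ, hδ, h⟩ := Metric.uniformContinuous_iff.1
    (CompactSpace.uniformContinuous_of_continuous hF) ε hε
  choose g hg hd using fun i => hs i (δ / 2) (by positivity)
  refine ⟨_, (IsStep.pi hg).comp F, fun π => (h ?_).le⟩
  exact ((dist_pi_le_iff (by positivity)).2 fun i => hd i π).trans_lt (by linarith)

theorem Approximable.comp₁ {s : Computation AP → unitInterval} (hs : Approximable e s)
    {F : unitInterval → unitInterval} (hF : Continuous F) : Approximable e fun π => F (s π) :=
  Approximable.comp (ι := Unit) (fun _ => hs) (F := fun x => F (x ()))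
    (hF.comp (continuous_apply _))

theorem Approximable.comp₂ {s₁ s₂ : Computation AP → unitInterval} (h₁ : Approximable e s₁)
    (h₂ : Approximable e s₂) {F : unitInterval × unitInterval → unitInterval}
    (hF : Continuous F) : Approximable e fun π => F (s₁ π, s₂ π) :=
  Approximable.comp (ι := Bool) (s := fun b => bif b then s₁ else s₂)
    (fun b => by cases b <;> assumption) (F := fun x => F (x true, x false))
    (hF.comp ((continuous_apply _).prodMk (continuous_apply _)))

theorem Approximable.suffix {s : Computation AP → unitInterval} (hs : Approximable e s) (i : ℕ) :
    Approximable e fun π => s (LTLDisc.suffix π i) := by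
  intro ε hε
  obtain ⟨g, hg, hd⟩ := hs ε hε
  exact ⟨_, hg.suffix i, fun π => hd _⟩

theorem dist_min_min_le {a b c d : unitInterval} {ε : ℝ} (h : dist a c ≤ ε) (h' : dist b d ≤ ε) :
    dist (min a b) (min c d) ≤ ε := by
  simp only [Subtype.dist_eq, Real.dist_eq] at *
  have (x y : unitInterval) : ((min x y : unitInterval) : ℝ) = min (x : ℝ) y :=
    (Subtype.mono_coe _).map_min
  rw [this, this]
  exact (abs_min_sub_min_le_max _ _ _ _).trans (max_le h h')

theorem le_add_of_dist_le {a b : unitInterval} {ε : ℝ} (h : dist a b ≤ ε) : (a : ℝ) ≤ b + ε := by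
  rw [Subtype.dist_eq, Real.dist_eq] at h
  linarith [le_abs_self ((a : ℝ) - b)]

theorem dist_le_of_le_add {a b : unitInterval} {ε : ℝ} (h : (a : ℝ) ≤ b + ε)
    (h' : (b : ℝ) ≤ a + ε) : dist a b ≤ ε := by
  rw [Subtype.dist_eq, Real.dist_eq, abs_le]
  constructor <;> linarith

theorem iSup_le_iSup_add {ι : Type*} {f g : ι → unitInterval} {ε : ℝ} (hε : 0 ≤ ε)
    (h : ∀ i, (f i : ℝ) ≤ g i + ε) :
    ((⨆ i, f i : unitInterval) : ℝ) ≤ (⨆ i, g i : unitInterval) + ε := by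
  set G := ⨆ i, g i
  by_cases hG : (G : ℝ) + ε ≤ 1
  · have : (⨆ i, f i) ≤ (⟨G + ε, by linarith [G.2.1], hG⟩ : unitInterval) := by
      refine iSup_le fun i => ?_
      rw [← Subtype.coe_le_coe]
      have : (g i : ℝ) ≤ G := le_iSup g i
      linarith [h i]
    exact this
  · linarith [(⨆ i, f i).2.2]

theorem iInf_le_iInf_add {ι : Type*} {f g : ι → unitInterval} {ε : ℝ} (hε : 0 ≤ ε)
    (h : ∀ i, (f i : ℝ) ≤ g i + ε) :
    ((⨅ i, f i : unitInterval) : ℝ) ≤ (⨅ i, g i : unitInterval) + ε := by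
  set G := ⨅ i, f i
  by_cases hG : 0 ≤ (G : ℝ) - ε
  · have : (⟨G - ε, hG, by linarith [G.2.2]⟩ : unitInterval) ≤ ⨅ i, g i := by
      refine le_iInf fun i => ?_
      rw [← Subtype.coe_le_coe]
      have : (G : ℝ) ≤ f i := iInf_le f i
      linarith [h i]
    have : (G : ℝ) - ε ≤ (⨅ i, g i : unitInterval) := this
    linarith
  · linarith [(⨅ i, g i).2.1]

theorem dist_iSup_iSup_le {ι : Type*} {f g : ι → unitInterval} {ε : ℝ} (hε : 0 ≤ ε)
    (h : ∀ i, dist (f i) (g i) ≤ ε) : dist (⨆ i, f i) (⨆ i, g i) ≤ ε :=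
  dist_le_of_le_add (iSup_le_iSup_add hε fun i => le_add_of_dist_le (h i))
    (iSup_le_iSup_add hε fun i => le_add_of_dist_le (dist_comm (f i) (g i) ▸ h i))

theorem dist_iInf_iInf_le {ι : Type*} {f g : ι → unitInterval} {ε : ℝ} (hε : 0 ≤ ε)
    (h : ∀ i, dist (f i) (g i) ≤ ε) : dist (⨅ i, f i) (⨅ i, g i) ≤ ε :=
  dist_le_of_le_add (iInf_le_iInf_add hε fun i => le_add_of_dist_le (h i))
    (iInf_le_iInf_add hε fun i => le_add_of_dist_le (dist_comm (f i) (g i) ▸ h i))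

theorem Approximable.untl {s₁ s₂ : Computation AP → unitInterval} (h₁ : Approximable e s₁)
    (h₂ : Approximable e s₂) :
    Approximable e fun π => ⨆ i : ℕ, min (s₂ (LTLDisc.suffix π i))
      (⨅ j : Fin i, s₁ (LTLDisc.suffix π j)) := by
  intro ε hε
  obtain ⟨g₁, hg₁, hd₁⟩ := h₁ ε hε
  obtain ⟨g₂, hg₂, hd₂⟩ := h₂ ε hε
  exact ⟨_, hg₁.untl hg₂, fun π => dist_iSup_iSup_le hε.le fun i =>
    dist_min_min_le (hd₂ _) (dist_iInf_iInf_le hε.le fun j => hd₁ _)⟩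

theorem Approximable.iInf_fin {n : ℕ} {s : Fin n → Computation AP → unitInterval}
    (hs : ∀ i, Approximable e (s i)) : Approximable e fun π => ⨅ i, s i π := by
  refine .comp hs (F := fun x => ⨅ i, x i) ?_
  simp_rw [← Finset.inf_univ_eq_iInf]
  fun_prop

theorem Approximable.iSup_fin {n : ℕ} {s : Fin n → Computation AP → unitInterval}
    (hs : ∀ i, Approximable e (s i)) : Approximable e fun π => ⨆ i, s i π := by
  refine .comp hs (F := fun x => ⨆ i, x i) ?_
  simp_rw [← Finset.sup_univ_eq_iSup]
  fun_prop

theorem Approximable.inf {s₁ s₂ : Computation AP → unitInterval} (h₁ : Approximable e s₁)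
    (h₂ : Approximable e s₂) : Approximable e fun π => min (s₁ π) (s₂ π) :=
  h₁.comp₂ h₂ (F := fun x => min x.1 x.2) (by fun_prop)

theorem Approximable.const_mul {s : Computation AP → unitInterval} (h : Approximable e s)
    (c : unitInterval) : Approximable e fun π => c * s π :=
  h.comp₁ (F := fun x => c * x) (by fun_prop)

theorem Approximable.discUntl (η : DiscountingFunction) {s₁ s₂ : Computation AP → unitInterval}
    (h₁ : Approximable e s₁) (h₂ : Approximable e s₂) :
    Approximable e fun π => ⨆ i : ℕ, min (η.toFun i * s₂ (LTLDisc.suffix π i))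
      (⨅ j : Fin i, η.toFun j * s₁ (LTLDisc.suffix π j)) := by
  refine .of_forall_dist_le fun ε hε => ?_
  obtain ⟨N, hN⟩ : ∃ N, (η.toFun N : ℝ) < ε := by
    have : Filter.Tendsto (fun n => (η.toFun n : ℝ)) Filter.atTop (nhds 0) :=
      (continuous_subtype_val.tendsto (0 : unitInterval)).comp η.tendsto_zero'
    exact (this.eventually (gt_mem_nhds hε)).exists
  refine ⟨_, Approximable.iSup_fin (n := N) fun i =>
    ((h₂.suffix i).const_mul (η.toFun i)).inf
      (.iInf_fin fun j : Fin i => (h₁.suffix j).const_mul (η.toFun j)), fun π => ?_⟩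
  set f : ℕ → unitInterval := fun i => min (η.toFun i * s₂ (LTLDisc.suffix π i))
    (⨅ j : Fin i, η.toFun j * s₁ (LTLDisc.suffix π j)) with hf
  change dist (⨆ i, f i) (⨆ i : Fin N, f i) ≤ ε
  have hle : (⨆ i : Fin N, f i) ≤ ⨆ i, f i := iSup_le fun i => le_iSup f i
  refine dist_le_of_le_add ?_ ((Subtype.coe_le_coe.2 hle).trans (by linarith))
  have hsup : (⨆ i, f i) ≤ max (⨆ i : Fin N, f i) (η.toFun N) := by
    refine iSup_le fun i => ?_
    rcases lt_or_ge i N with hi | hi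
    · exact le_max_of_le_left (le_iSup (fun i : Fin N => f i) ⟨i, hi⟩)
    · refine le_max_of_le_right ((min_le_left _ _).trans ?_)
      exact unitInterval.mul_le_left.trans (η.strictAnti'.antitone hi)
  rcases le_max_iff.1 hsup with h | h
  · exact (Subtype.coe_le_coe.2 h).trans (by linarith)
  · exact (Subtype.coe_le_coe.2 h).trans (by linarith [(⨆ i : Fin N, f i).2.1])

theorem approximable_sem (he : Function.Injective e) {𝒟 : Set DiscountingFunction}
    (φ : Formula AP 𝒟 monotoneContinuousOperators) : Approximable e φ.sem := by
  induction φ with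
  | tru => exact (isStep_const 1).approximable
  | atom p =>
    refine IsStep.approximable ?_
    classical
    convert (IsStep.prop (definable_letter (e := e) (e '' {a | p ∈ a}))).comp
      fun q => if q then (1 : unitInterval) else 0 with π
    simp only [Formula.sem, Set.mem_ofPred_eq, he.mem_set_image]
  | neg φ ih => exact ih.comp₁ unitInterval.continuous_symm
  | and φ₁ φ₂ ih₁ ih₂ => exact ih₁.inf ih₂
  | next φ ih => exact ih.suffix 1
  | untl φ₁ φ₂ ih₁ ih₂ => exact ih₁.untl ih₂
  | discUntl η hη φ₁ φ₂ ih₁ ih₂ => exact ih₁.discUntl η ih₂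
  | op f hf φ ih => exact .comp ih hf.2

theorem DiscountSeq.continuous_act (d : DiscountSeq) : Continuous d.act := by
  induction d with
  | single d => exact continuous_const.mul continuous_id
  | snoc ds d ih =>
    exact ih.comp (unitInterval.continuous_symm.comp (continuous_const.mul continuous_id))

/-- Uniform limits of step functions are approximated from below by alternating automata. -/
theorem Approximable.exists_automaton [Finite AP] {s : Computation AP → unitInterval}
    (hs : Approximable e s) {ε : ℝ} (hε : 0 < ε) :
    ∃ 𝒜 : AltAutomaton (Set AP), ∀ π, (s π : ℝ) - ε ≤ 𝒜.language π ∧ 𝒜.language π ≤ s π := by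
  obtain ⟨g, hg, hd⟩ := hs (ε / 2) (by positivity)
  have : Finite (Set.range g) := hg.1
  choose ψ hψ using fun c : Set.range g => hg.2 {c.1}
  let v : Set.range g → unitInterval := fun c => Set.projIcc 0 1 zero_le_one (c.1 - ε / 2)
  have hv (c : Set.range g) : (v c : ℝ) = max 0 (min 1 ((c.1 : ℝ) - ε / 2)) :=
    Set.coe_projIcc _ _ _ _
  have hπ (π : Computation AP) : |(s π : ℝ) - g π| ≤ ε / 2 := hd π
  refine ⟨thresholdAutomaton e v ψ, fun π => ⟨?_, ?_⟩⟩
  · have h : v ⟨g π, π, rfl⟩ ≤ (thresholdAutomaton e v ψ).language π :=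
      le_language_thresholdAutomaton e v ψ π _ ((hψ ⟨g π, π, rfl⟩ π).1 rfl)
    refine le_trans ?_ (Subtype.coe_le_coe.2 h)
    rw [hv]
    refine le_max_of_le_right (le_min ?_ ?_)
    · linarith [(s π).2.2]
    · linarith [(abs_le.1 (hπ π)).2]
  · refine language_thresholdAutomaton_le e v ψ π _ fun c hc => ?_
    have hc : g π = c.1 := (hψ c π).2 hc
    rw [← Subtype.coe_le_coe, hv, ← hc]
    refine max_le (s π).2.1 ((min_le_right _ _).trans ?_)
    linarith [(abs_le.1 (hπ π)).1]

end Approximation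
end LTLDisc

theorem mainTheorem5 {AP : Type*} [Finite AP] (𝒟 : Set LTLDisc.DiscountingFunction)
    (φ : LTLDisc.Formula AP 𝒟 LTLDisc.monotoneContinuousOperators)
    (ε : ℝ) (hε : ε ∈ Set.Ioo (0 : ℝ) 1) (d : LTLDisc.DiscountSeq) :
    ∃ 𝒜 : LTLDisc.AltAutomaton (Set AP), ∀ π : LTLDisc.Computation AP,
      ((d.act (φ.sem π) : unitInterval) : ℝ) - ε ≤ (𝒜.language π : ℝ) ∧
        𝒜.language π ≤ d.act (φ.sem π) := by
  obtain ⟨n, ⟨e⟩⟩ := Finite.exists_equiv_fin (Set AP)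
  exact ((LTLDisc.approximable_sem e.injective φ).comp₁ d.continuous_act).exists_automaton hε.1
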